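/- For a real-valued function $f\in L^2(0,\pi/2)$ put $$L(f)=\int_0^{\pi/2} f(x)\log(\tan x)\,dx,\qquad \langle f,g\rangle=\frac{2}{\pi}\int_0^{\pi/2}f(x)g(x)\,dx\quad (g\in L^2(0,\pi/2)),$$ and let $$\tilde P_n(x)=\frac{(-1)^n}{n!}\Big(\frac2\pi\Big)^n\frac{d^n}{dx^n}\Big[x^n\Big(\frac{\pi}{2}-x\Big)^n\Big]\qquad(n\ge 0)$$ be the Legendre polynomials shifted to $[0,\pi/2]$. For integers $1\le k\le N$ define the real numbers $$c_{N,k}(f)=2\sum_{j=k}^{N}(4j-1)\,\langle f,\tilde P_{2j-1}\rangle\,\frac{(2j+2k-2)!}{(2k-1)!\,(2j-2k)!}.$$ Then, for every real-valued square-integrable function $f$ on $(0,\pi/2)$, the integral $L(f)$ converges absolutely and $$L(f)=\lim_{N\to\infty}\sum_{k=1}^{N}c_{N,k}(f)\,\frac{(-1)^{k-1}}{\pi^{2k-1}}\Big(1-\frac{1}{2^{2k+1}}\Big)\zeta(2k+1),$$ where $\zeta$ is the Riemann zeta function. -/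

import Mathlib

open MeasureTheory Filter
open scoped Topology

noncomputable section

namespace LogTangent

/-- The log-tangent integral `L(f) = ∫_0^{π/2} f(x) log(tan x) dx`. -/
def L (f : ℝ → ℝ) : ℝ :=
  ∫ x in (0 : ℝ)..(Real.pi / 2), f x * Real.log (Real.tan x)

/-- The inner product `⟨f, g⟩ = (2/π) ∫_0^{π/2} f(x) g(x) dx`. -/
def innerProd (f g : ℝ → ℝ) : ℝ :=
  (2 / Real.pi) * ∫ x in (0 : ℝ)..(Real.pi / 2), f x * g x

/-- The Legendre polynomials shifted to `[0, π/2]`, by Rodrigues' formula. -/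
def shiftedP (n : ℕ) (x : ℝ) : ℝ :=
  (-1) ^ n / (Nat.factorial n : ℝ) * (2 / Real.pi) ^ n *
    iteratedDeriv n (fun y : ℝ => y ^ n * (Real.pi / 2 - y) ^ n) x

/-- The coefficients `c_{N,k}(f)`, meant for `1 ≤ k ≤ N`; the natural-number subtractions do not
truncate there. -/
def coeff (f : ℝ → ℝ) (N k : ℕ) : ℝ :=
  2 * ∑ j ∈ Finset.Icc k N, (4 * (j : ℝ) - 1) * innerProd f (shiftedP (2 * j - 1)) *
    ((Nat.factorial (2 * j + 2 * k - 2) : ℝ) /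
      ((Nat.factorial (2 * k - 1) : ℝ) * (Nat.factorial (2 * j - 2 * k) : ℝ)))

end LogTangent

end

namespace LogTangent

open Polynomial

/-! ### Generalities on polynomials -/

theorem iterate_derivative_comp_C_mul_X {R : Type*} [CommSemiring R] (a : R) (p : R[X]) (k : ℕ) :
    derivative^[k] (p.comp (C a * X)) = C (a ^ k) * (derivative^[k] p).comp (C a * X) := by
  induction k generalizing p with
  | zero => simp
  | succ k ih =>
    rw [Function.iterate_succ_apply, Function.iterate_succ_apply, derivative_comp]
    simp only [derivative_mul, derivative_C, derivative_X, zero_mul, zero_add, mul_one]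
    rw [iterate_derivative_C_mul, ih, pow_succ, C_mul]
    ring

theorem iteratedDeriv_eval (p : ℝ[X]) (n : ℕ) :
    iteratedDeriv n (fun x => p.eval x) = fun x => (derivative^[n] p).eval x := by
  induction n with
  | zero => simp
  | succ n ih =>
    rw [iteratedDeriv_succ, ih, Function.iterate_succ_apply']
    ext x
    simp

/-- Integration by parts for polynomials. -/
theorem integral_eval_derivative_mul (p q : ℝ[X]) (a b : ℝ) :
    ∫ x in a..b, (derivative p).eval x * q.eval x =
      p.eval b * q.eval b - p.eval a * q.eval a
        - ∫ x in a..b, p.eval x * (derivative q).eval x := by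
  have h := intervalIntegral.integral_deriv_mul_eq_sub (a := a) (b := b)
    (u := fun x => p.eval x) (v := fun x => q.eval x)
    (u' := fun x => (derivative p).eval x) (v' := fun x => (derivative q).eval x)
    (fun x _ => p.hasDerivAt x) (fun x _ => q.hasDerivAt x)
    ((derivative p).continuous.intervalIntegrable _ _)
    ((derivative q).continuous.intervalIntegrable _ _)
  rw [intervalIntegral.integral_add] at h
  · linarith
  · exact ((derivative p).continuous.mul q.continuous).intervalIntegrable _ _
  · exact (p.continuous.mul (derivative q).continuous).intervalIntegrable _ _

theorem integral_eval_iterate_derivative_mul (w q : ℝ[X]) (a b : ℝ) (n : ℕ)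
    (ha : ∀ i < n, (derivative^[i] w).eval a = 0) (hb : ∀ i < n, (derivative^[i] w).eval b = 0) :
    ∫ x in a..b, (derivative^[n] w).eval x * q.eval x =
      (-1) ^ n * ∫ x in a..b, w.eval x * (derivative^[n] q).eval x := by
  induction n generalizing q with
  | zero => simp
  | succ n ih =>
    rw [Function.iterate_succ_apply', integral_eval_derivative_mul, ha n (by simp), hb n (by simp),
      ih _ (fun i hi => ha i (by lia)) (fun i hi => hb i (by lia)), Function.iterate_succ_apply]
    ring

/-! ### The shifted Legendre polynomials as elements of `ℝ[X]` -/

/-- The shifted Legendre polynomial with real coefficients, on the interval `[0, 1]`. -/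
noncomputable def unitLegendre (n : ℕ) : ℝ[X] :=
  (shiftedLegendre n).map (Int.castRingHom ℝ)

/-- The Legendre polynomial on the interval `[0, π / 2]`. -/
noncomputable def legendrePoly (n : ℕ) : ℝ[X] :=
  C ((-1) ^ n) * (unitLegendre n).comp (C (2 / Real.pi) * X)

theorem factorial_mul_unitLegendre (n : ℕ) :
    C (n.factorial : ℝ) * unitLegendre n = derivative^[n] (X ^ n * (1 - X) ^ n) := by
  have h := congrArg (Polynomial.map (Int.castRingHom ℝ)) (factorial_mul_shiftedLegendre_eq n)
  rw [← iterate_derivative_map] at h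
  simpa [unitLegendre] using h

theorem coeff_unitLegendre (n k : ℕ) :
    (unitLegendre n).coeff k = (-1) ^ k * n.choose k * (n + k).choose n := by
  simp [unitLegendre, coeff_shiftedLegendre]

theorem natDegree_unitLegendre (n : ℕ) : (unitLegendre n).natDegree = n := by
  rw [unitLegendre, natDegree_map_eq_of_injective, natDegree_shiftedLegendre]
  exact Int.cast_injective

theorem unitLegendre_comp_one_sub_X (n : ℕ) :
    (unitLegendre n).comp (1 - X) = C ((-1) ^ n) * unitLegendre n := by
  have h := congrArg (Polynomial.map (Int.castRingHom ℝ))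
    (neg_one_pow_mul_shiftedLegendre_comp_one_sub_X_eq n)
  simp only [Polynomial.map_mul, Polynomial.map_pow, Polynomial.map_neg, Polynomial.map_one,
    Polynomial.map_comp, Polynomial.map_sub, map_X] at h
  rw [unitLegendre]
  conv_rhs => rw [← h, ← mul_assoc]
  simp [← mul_pow]

theorem legendrePoly_eq_iterate_derivative (n : ℕ) :
    legendrePoly n = C ((-1) ^ n / (n.factorial : ℝ) * (2 / Real.pi) ^ n) *
      derivative^[n] (X ^ n * (C (Real.pi / 2) - X) ^ n) := by
  have hpi := Real.pi_ne_zero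
  have hw : (X ^ n * (C (Real.pi / 2) - X) ^ n : ℝ[X]) = C ((Real.pi / 2) ^ (2 * n)) *
      (X ^ n * (1 - X) ^ n : ℝ[X]).comp (C (2 / Real.pi) * X) := by
    apply Polynomial.funext
    intro x
    simp only [eval_mul, eval_pow, eval_X, eval_sub, eval_C, eval_comp, eval_one]
    rw [pow_mul, ← mul_pow, ← mul_pow, ← mul_pow]
    congr 1
    field_simp
  rw [hw, iterate_derivative_C_mul, iterate_derivative_comp_C_mul_X, ← factorial_mul_unitLegendre,
    legendrePoly, mul_comp, C_comp]
  simp only [← mul_assoc, ← C_mul]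
  congr 2
  have : (n.factorial : ℝ) ≠ 0 := by positivity
  rw [two_mul, pow_add]
  have h2 : (2 / Real.pi) ^ n * (Real.pi / 2) ^ n = 1 := by
    rw [← mul_pow]; field_simp; simp
  field_simp
  linear_combination (-1 - (2 / Real.pi) ^ n * (Real.pi / 2) ^ n) * h2

theorem shiftedP_eq_eval (n : ℕ) (x : ℝ) : shiftedP n x = (legendrePoly n).eval x := by
  rw [shiftedP, legendrePoly_eq_iterate_derivative, eval_mul, eval_C]
  congr 1
  rw [show (fun y : ℝ => y ^ n * (Real.pi / 2 - y) ^ n) =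
    fun y => (X ^ n * (C (Real.pi / 2) - X) ^ n : ℝ[X]).eval y by ext; simp, iteratedDeriv_eval]

theorem natDegree_legendrePoly (n : ℕ) : (legendrePoly n).natDegree = n := by
  have hpi := Real.pi_ne_zero
  rw [legendrePoly, natDegree_C_mul (by simp), natDegree_comp, natDegree_unitLegendre,
    natDegree_C_mul_X _ (by positivity), mul_one]

theorem eval_iterate_derivative_legendrePoly (n k : ℕ) (x : ℝ) :
    (derivative^[k] (legendrePoly n)).eval x =
      (-1) ^ n * (2 / Real.pi) ^ k * (derivative^[k] (unitLegendre n)).eval (2 / Real.pi * x) := by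
  rw [legendrePoly, iterate_derivative_C_mul, iterate_derivative_comp_C_mul_X]
  simp [mul_assoc]

theorem eval_iterate_derivative_legendrePoly_zero (n k : ℕ) :
    (derivative^[k] (legendrePoly n)).eval 0 =
      (-1) ^ (n + k) * (2 / Real.pi) ^ k * (k.factorial * n.choose k * (n + k).choose n) := by
  rw [eval_iterate_derivative_legendrePoly, mul_zero, ← coeff_zero_eq_eval_zero,
    coeff_iterate_derivative, coeff_unitLegendre]
  simp only [zero_add, Nat.descFactorial_self, nsmul_eq_mul]
  ring

theorem eval_iterate_derivative_legendrePoly_pi_div_two (n k : ℕ) :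
    (derivative^[k] (legendrePoly n)).eval (Real.pi / 2) =
      (-1) ^ (n + k) * (derivative^[k] (legendrePoly n)).eval 0 := by
  have hpi := Real.pi_ne_zero
  have h := congrArg (fun p : ℝ[X] => (derivative^[k] p).eval 0) (unitLegendre_comp_one_sub_X n)
  simp only [iterate_derivative_comp_one_sub_X, iterate_derivative_C_mul, eval_mul, eval_comp,
    eval_sub, eval_one, eval_X, sub_zero, eval_C, eval_pow, eval_neg] at h
  rw [eval_iterate_derivative_legendrePoly, eval_iterate_derivative_legendrePoly, mul_zero,
    show 2 / Real.pi * (Real.pi / 2) = 1 by field_simp]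
  have h1 : ((-1 : ℝ) ^ k) * (-1) ^ k = 1 := by rw [← mul_pow]; simp
  calc _ = (-1) ^ n * (2 / Real.pi) ^ k * ((-1) ^ k * ((-1) ^ k *
        (derivative^[k] (unitLegendre n)).eval 1)) := by rw [← mul_assoc ((-1) ^ k), h1, one_mul]
    _ = _ := by rw [h, pow_add]; ring

theorem sq_eval_legendrePoly_pi_div_two (n : ℕ) :
    (legendrePoly n).eval (Real.pi / 2) ^ 2 = 1 := by
  have h := eval_iterate_derivative_legendrePoly_pi_div_two n 0
  have h0 := eval_iterate_derivative_legendrePoly_zero n 0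
  simp only [Function.iterate_zero, id_eq] at h h0
  rw [h, h0]
  simp [← mul_pow]

/-! ### Orthogonality -/

theorem integral_legendrePoly_mul_of_natDegree_lt (n : ℕ) (q : ℝ[X]) (hq : q.natDegree < n) :
    ∫ x in (0 : ℝ)..(Real.pi / 2), (legendrePoly n).eval x * q.eval x = 0 := by
  set w : ℝ[X] := X ^ n * (C (Real.pi / 2) - X) ^ n
  have h0 : ∀ i < n, (derivative^[i] w).eval 0 = 0 := fun i hi => by
    have h := pow_sub_dvd_iterate_derivative_of_pow_dvd i (Dvd.intro _ rfl : X ^ n ∣ w)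
    obtain ⟨r, hr⟩ := h
    rw [hr]
    simp [show n - i ≠ 0 by lia]
  have h1 : ∀ i < n, (derivative^[i] w).eval (Real.pi / 2) = 0 := fun i hi => by
    have h := pow_sub_dvd_iterate_derivative_of_pow_dvd i
      (Dvd.intro_left _ rfl : (C (Real.pi / 2) - X) ^ n ∣ w)
    obtain ⟨r, hr⟩ := h
    rw [hr]
    simp [show n - i ≠ 0 by lia]
  have h := integral_eval_iterate_derivative_mul w q 0 (Real.pi / 2) n h0 h1
  rw [iterate_derivative_eq_zero hq] at h
  simp only [eval_zero, mul_zero, intervalIntegral.integral_zero] at h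
  simp_rw [legendrePoly_eq_iterate_derivative, eval_mul, eval_C, mul_assoc]
  simp only [intervalIntegral.integral_const_mul]
  rw [h]
  simp

theorem integral_legendrePoly_mul_legendrePoly_of_ne {m n : ℕ} (h : m ≠ n) :
    ∫ x in (0 : ℝ)..(Real.pi / 2), (legendrePoly m).eval x * (legendrePoly n).eval x = 0 := by
  rcases lt_or_gt_of_ne h with h | h
  · simp_rw [mul_comm ((legendrePoly m).eval _)]
    exact integral_legendrePoly_mul_of_natDegree_lt n _ (by rwa [natDegree_legendrePoly])
  · exact integral_legendrePoly_mul_of_natDegree_lt m _ (by rwa [natDegree_legendrePoly])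

theorem integral_legendrePoly_sq (n : ℕ) :
    (2 * n + 1) * ∫ x in (0 : ℝ)..(Real.pi / 2),
      (legendrePoly n).eval x * (legendrePoly n).eval x = Real.pi / 2 := by
  set P := legendrePoly n with hP
  have hdeg : P.natDegree = n := natDegree_legendrePoly n
  set R : ℝ[X] := X * derivative P - C (n : ℝ) * P
  have hR : ∫ x in (0 : ℝ)..(Real.pi / 2), P.eval x * R.eval x = 0 := by
    rcases Nat.eq_zero_or_pos n with hn | hn
    · have : R = 0 := by
        have h0 : derivative P = 0 := derivative_of_natDegree_zero (by lia)
        simp [R, h0, hn]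
      simp [this]
    · apply integral_legendrePoly_mul_of_natDegree_lt
      by_cases hR0 : R = 0
      · simpa [hR0] using hn
      rw [natDegree_lt_iff_degree_lt hR0, degree_lt_iff_coeff_zero]
      intro m hm
      obtain ⟨m, rfl⟩ : ∃ k, m = k + 1 := ⟨m - 1, by lia⟩
      simp only [R, coeff_sub, coeff_X_mul, coeff_derivative, coeff_C_mul]
      rcases hm.eq_or_lt with h | h
      · rw [h]; push_cast; ring
      · rw [coeff_eq_zero_of_natDegree_lt (by lia)]; ring
  have hparts := integral_eval_derivative_mul (X * P) P 0 (Real.pi / 2)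
  have e1 : ∫ x in (0 : ℝ)..(Real.pi / 2), (derivative (X * P)).eval x * P.eval x =
      (n + 1) * ∫ x in (0 : ℝ)..(Real.pi / 2), P.eval x * P.eval x := by
    have : ∀ x, (derivative (X * P)).eval x * P.eval x =
        (n + 1) * (P.eval x * P.eval x) + P.eval x * R.eval x := fun x => by
      simp [R]; ring
    simp_rw [this]
    rw [intervalIntegral.integral_add, hR, intervalIntegral.integral_const_mul, add_zero]
    · exact (by fun_prop : Continuous _).intervalIntegrable _ _
    · exact (by fun_prop : Continuous _).intervalIntegrable _ _
  have e2 : ∫ x in (0 : ℝ)..(Real.pi / 2), (X * P).eval x * (derivative P).eval x =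
      n * ∫ x in (0 : ℝ)..(Real.pi / 2), P.eval x * P.eval x := by
    have : ∀ x, (X * P).eval x * (derivative P).eval x =
        n * (P.eval x * P.eval x) + P.eval x * R.eval x := fun x => by
      simp [R]; ring
    simp_rw [this]
    rw [intervalIntegral.integral_add, hR, intervalIntegral.integral_const_mul, add_zero]
    · exact (by fun_prop : Continuous _).intervalIntegrable _ _
    · exact (by fun_prop : Continuous _).intervalIntegrable _ _
  rw [e1, e2] at hparts
  have hb := sq_eval_legendrePoly_pi_div_two n
  rw [← hP] at hb
  simp only [eval_mul, eval_X] at hparts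
  linear_combination hparts + Real.pi / 2 * hb

theorem span_range_legendrePoly : Submodule.span ℝ (Set.range legendrePoly) = ⊤ := by
  have hne : ∀ n, legendrePoly n ≠ 0 := fun n h => by
    have := sq_eval_legendrePoly_pi_div_two n
    simp [h] at this
  let S : Polynomial.Sequence ℝ := ⟨legendrePoly, fun n => by
    rw [degree_eq_natDegree (hne n), natDegree_legendrePoly]⟩
  exact S.span fun n => isUnit_iff_ne_zero.mpr (leadingCoeff_ne_zero.mpr (hne n))

/-! ### Square integrability of `log tan` -/

theorem abs_log_le_rpow {t : ℝ} (h0 : 0 < t) (h1 : t ≤ 1) :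
    |Real.log t| ≤ 4 * t ^ (-(1 / 4 : ℝ)) := by
  have h := (Real.abs_log_mul_self_rpow_lt t (1 / 4) h0 h1 (by norm_num)).le
  have hp : 0 < t ^ (1 / 4 : ℝ) := Real.rpow_pos_of_pos h0 _
  rw [abs_mul, abs_of_pos hp] at h
  rw [Real.rpow_neg h0.le, ← div_eq_mul_inv, le_div_iff₀ hp]
  linarith

theorem abs_log_sin_le {x : ℝ} (h0 : 0 < x) (h1 : x ≤ Real.pi / 2) :
    |Real.log (Real.sin x)| ≤ 4 * (2 / Real.pi * x) ^ (-(1 / 4 : ℝ)) := by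
  have hpi := Real.pi_pos
  have hle := Real.mul_le_sin h0.le h1
  have hpos : 0 < 2 / Real.pi * x := by positivity
  refine le_trans ?_ (abs_log_le_rpow hpos (hle.trans (Real.sin_le_one x)))
  rw [abs_of_nonpos (Real.log_nonpos (hpos.trans_le hle).le (Real.sin_le_one x)),
    abs_of_nonpos (Real.log_nonpos hpos.le (hle.trans (Real.sin_le_one x)))]
  exact neg_le_neg (Real.log_le_log hpos hle)

theorem log_tan_eq {x : ℝ} (hx : x ∈ Set.Ioo 0 (Real.pi / 2)) :
    Real.log (Real.tan x) = Real.log (Real.sin x) - Real.log (Real.cos x) := by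
  have hs : 0 < Real.sin x := Real.sin_pos_of_pos_of_lt_pi hx.1 (by linarith [hx.2, Real.pi_pos])
  have hc : 0 < Real.cos x := Real.cos_pos_of_mem_Ioo ⟨by linarith [hx.1, Real.pi_pos], hx.2⟩
  rw [Real.tan_eq_sin_div_cos, Real.log_div hs.ne' hc.ne']

theorem measurable_log_sin : Measurable fun x => Real.log (Real.sin x) :=
  Real.measurable_log.comp Real.measurable_sin

theorem intervalIntegrable_log_sin_sq :
    IntervalIntegrable (fun x => Real.log (Real.sin x) ^ 2) volume 0 (Real.pi / 2) := by
  have hpi := Real.pi_pos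
  have hint : IntervalIntegrable
      (fun x : ℝ => 16 * (2 / Real.pi) ^ (-(1 / 2) : ℝ) * x ^ (-(1 / 2) : ℝ)) volume
      0 (Real.pi / 2) :=
    (intervalIntegral.intervalIntegrable_rpow' (by norm_num)).const_mul _
  refine hint.mono_fun' (measurable_log_sin.pow_const 2).aestronglyMeasurable ?_
  refine (ae_restrict_iff' measurableSet_uIoc).mpr (ae_of_all _ fun x hx => ?_)
  rw [Set.uIoc_of_le (by positivity)] at hx
  have h := abs_log_sin_le hx.1 hx.2
  have hpos : 0 < 2 / Real.pi * x := by have := hx.1; positivity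
  simp only [Real.norm_eq_abs, abs_pow]
  calc _ ≤ (4 * (2 / Real.pi * x) ^ (-(1 / 4 : ℝ))) ^ 2 := by gcongr
    _ = _ := by
      rw [mul_pow, ← Real.rpow_natCast, ← Real.rpow_natCast, ← Real.rpow_mul hpos.le,
        Real.mul_rpow (by positivity) hx.1.le]
      norm_num
      ring

theorem memLp_log_sin :
    MemLp (fun x => Real.log (Real.sin x)) 2 (volume.restrict (Set.Ioo 0 (Real.pi / 2))) := by
  rw [memLp_two_iff_integrable_sq measurable_log_sin.aestronglyMeasurable]
  exact (intervalIntegrable_iff_integrableOn_Ioo_of_le (by positivity)).mp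
    intervalIntegrable_log_sin_sq

theorem memLp_log_cos :
    MemLp (fun x => Real.log (Real.cos x)) 2 (volume.restrict (Set.Ioo 0 (Real.pi / 2))) := by
  have hm : Measurable fun x => Real.log (Real.cos x) :=
    Real.measurable_log.comp Real.measurable_cos
  rw [memLp_two_iff_integrable_sq hm.aestronglyMeasurable]
  refine (intervalIntegrable_iff_integrableOn_Ioo_of_le (by positivity)).mp ?_
  have h := (intervalIntegrable_log_sin_sq.comp_sub_left (Real.pi / 2)).symm
  simpa [Real.sin_pi_div_two_sub] using h

theorem memLp_log_tan :
    MemLp (fun x => Real.log (Real.tan x)) 2 (volume.restrict (Set.Ioo 0 (Real.pi / 2))) := by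
  refine (memLp_log_sin.sub memLp_log_cos).ae_eq ?_
  filter_upwards [ae_restrict_mem measurableSet_Ioo] with x hx
  exact (log_tan_eq hx).symm

theorem memLp_eval (p : ℝ[X]) :
    MemLp (fun x => p.eval x) 2 (volume.restrict (Set.Ioo 0 (Real.pi / 2))) := by
  rw [memLp_two_iff_integrable_sq p.continuous.aestronglyMeasurable]
  exact (intervalIntegrable_iff_integrableOn_Ioo_of_le (by positivity)).mp
    ((p.continuous.pow 2).intervalIntegrable _ _)

/-! ### Completeness of the Legendre polynomials -/

theorem intervalIntegral_eq_setIntegral_Ioo (g : ℝ → ℝ) :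
    ∫ x in (0 : ℝ)..(Real.pi / 2), g x = ∫ x in Set.Ioo 0 (Real.pi / 2), g x := by
  rw [intervalIntegral.integral_of_le (by positivity), integral_Ioc_eq_integral_Ioo]

theorem ae_eq_zero_of_forall_integral_polynomial_eq_zero {a b : ℝ} {h : ℝ → ℝ}
    (hh : IntegrableOn h (Set.Ioo a b))
    (h0 : ∀ p : ℝ[X], ∫ x in Set.Ioo a b, p.eval x * h x = 0) :
    h =ᵐ[volume.restrict (Set.Ioo a b)] 0 := by
  refine ae_eq_zero_of_integral_contDiff_smul_eq_zero
    (Integrable.locallyIntegrable hh) fun g hg _ => ?_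
  have key : ∀ ε > 0, |∫ x in Set.Ioo a b, g x * h x| ≤ ε * ∫ x in Set.Ioo a b, |h x| := by
    intro ε hε
    obtain ⟨p, hp⟩ := exists_polynomial_near_of_continuousOn a b g hg.continuous.continuousOn ε hε
    have hmul : ∀ q : ℝ → ℝ, Continuous q → IntegrableOn (fun x => q x * h x) (Set.Ioo a b) :=
      fun q hq => by
        obtain ⟨M, hM⟩ := isCompact_Icc.exists_bound_of_continuousOn
          (hq.continuousOn (s := Set.Icc a b))
        refine Integrable.bdd_mul hh hq.aestronglyMeasurable (c := M) ?_
        filter_upwards [ae_restrict_mem measurableSet_Ioo] with x hx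
        exact hM x (Set.Ioo_subset_Icc_self hx)
    have e : ∫ x in Set.Ioo a b, g x * h x = ∫ x in Set.Ioo a b, (g x - p.eval x) * h x := by
      simp_rw [sub_mul]
      rw [integral_sub (hmul _ hg.continuous) (hmul _ p.continuous), h0, sub_zero]
    rw [e, ← integral_const_mul ε, ← Real.norm_eq_abs]
    refine norm_integral_le_of_norm_le (hh.abs.const_mul ε) ?_
    filter_upwards [ae_restrict_mem measurableSet_Ioo] with x hx
    rw [norm_mul, Real.norm_eq_abs, Real.norm_eq_abs, abs_sub_comm]
    gcongr
    exact (hp x (Set.Ioo_subset_Icc_self hx)).le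
  have hlim : Tendsto (fun ε : ℝ => ε * ∫ x in Set.Ioo a b, |h x|) (𝓝[>] 0) (𝓝 0) := by
    have : Tendsto (fun ε : ℝ => ε * ∫ x in Set.Ioo a b, |h x|) (𝓝 0)
      (𝓝 (0 * ∫ x in Set.Ioo a b, |h x|)) := tendsto_id.mul_const _
    rw [zero_mul] at this
    exact this.mono_left nhdsWithin_le_nhds
  have hle := ge_of_tendsto hlim (by filter_upwards [self_mem_nhdsWithin] with ε hε using key ε hε)
  simpa using abs_nonpos_iff.mp hle

/-- The square-integrable functions on `(0, π / 2)`. -/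
noncomputable abbrev LegendreSpace := Lp ℝ 2 (volume.restrict (Set.Ioo 0 (Real.pi / 2)))

theorem inner_toLp {f g : ℝ → ℝ} (hf : MemLp f 2 (volume.restrict (Set.Ioo 0 (Real.pi / 2))))
    (hg : MemLp g 2 (volume.restrict (Set.Ioo 0 (Real.pi / 2)))) :
    inner ℝ (hf.toLp f : LegendreSpace) (hg.toLp g) = ∫ x in (0 : ℝ)..(Real.pi / 2), f x * g x := by
  rw [L2.inner_def, intervalIntegral_eq_setIntegral_Ioo]
  refine integral_congr_ae ?_
  filter_upwards [hf.coeFn_toLp, hg.coeFn_toLp] with x h1 h2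
  rw [h1, h2]
  simp [mul_comm]

/-- The normalized Legendre polynomials in `L²(0, π / 2)`. -/
noncomputable def legendreLp (n : ℕ) : LegendreSpace :=
  √((2 * n + 1) * (2 / Real.pi)) • (memLp_eval (legendrePoly n)).toLp _

theorem orthonormal_legendreLp : Orthonormal ℝ legendreLp := by
  have hpi := Real.pi_pos
  rw [orthonormal_iff_ite]
  intro m n
  rw [legendreLp, legendreLp, inner_smul_left, inner_smul_right, inner_toLp]
  split_ifs with h
  · subst h
    have h := integral_legendrePoly_sq m
    simp only [conj_trivial]
    rw [← mul_assoc, Real.mul_self_sqrt (by positivity)]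
    calc _ = (2 / Real.pi) * ((2 * m + 1) * ∫ x in (0 : ℝ)..(Real.pi / 2),
          (legendrePoly m).eval x * (legendrePoly m).eval x) := by ring
      _ = 1 := by rw [h]; field_simp
  · rw [integral_legendrePoly_mul_legendrePoly_of_ne h]
    simp

theorem orthogonal_span_legendreLp : (Submodule.span ℝ (Set.range legendreLp))ᗮ = ⊥ := by
  have hpi := Real.pi_pos
  rw [Submodule.eq_bot_iff]
  intro h hh
  have hmem : MemLp h 2 (volume.restrict (Set.Ioo 0 (Real.pi / 2))) := Lp.memLp h
  have hint : ∀ p : ℝ[X], IntegrableOn (fun x => p.eval x * h x) (Set.Ioo 0 (Real.pi / 2)) :=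
    fun p => (memLp_eval p).integrable_mul hmem
  have hL : ∀ n, ∫ x in Set.Ioo 0 (Real.pi / 2), (legendrePoly n).eval x * h x = 0 := fun n => by
    have h1 := (Submodule.mem_orthogonal _ _).mp hh (legendreLp n)
      (Submodule.subset_span ⟨n, rfl⟩)
    rw [legendreLp, inner_smul_left] at h1
    have h2 := (mul_eq_zero.mp h1).resolve_left (by
      simpa using (Real.sqrt_pos.mpr (by positivity)).ne')
    rw [← Lp.toLp_coeFn h hmem, inner_toLp, intervalIntegral_eq_setIntegral_Ioo] at h2
    exact h2
  have hpoly : ∀ p : ℝ[X], ∫ x in Set.Ioo 0 (Real.pi / 2), p.eval x * h x = 0 := fun p => by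
    have hp : p ∈ Submodule.span ℝ (Set.range legendrePoly) := by
      rw [span_range_legendrePoly]; trivial
    induction hp using Submodule.span_induction with
    | mem q hq => obtain ⟨n, rfl⟩ := hq; exact hL n
    | zero => simp
    | add q r _ _ hq hr =>
      simp_rw [eval_add, add_mul]
      rw [integral_add (hint q) (hint r), hq, hr, add_zero]
    | smul c q _ hq =>
      simp_rw [eval_smul, smul_eq_mul, mul_assoc]
      rw [integral_const_mul, hq, mul_zero]
  have h1 : IntegrableOn h (Set.Ioo 0 (Real.pi / 2)) := by simpa using hint 1
  exact (Lp.eq_zero_iff_ae_eq_zero).mpr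
    (ae_eq_zero_of_forall_integral_polynomial_eq_zero h1 hpoly)

/-- Parseval's identity for the Legendre polynomials on `[0, π / 2]`. -/
theorem hasSum_legendre_parseval {f g : ℝ → ℝ}
    (hf : MemLp f 2 (volume.restrict (Set.Ioo 0 (Real.pi / 2))))
    (hg : MemLp g 2 (volume.restrict (Set.Ioo 0 (Real.pi / 2)))) :
    HasSum (fun n : ℕ => (2 * n + 1) * innerProd f (shiftedP n) *
        ∫ x in (0 : ℝ)..(Real.pi / 2), shiftedP n x * g x)
      (∫ x in (0 : ℝ)..(Real.pi / 2), f x * g x) := by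
  have hpi := Real.pi_pos
  have h := (HilbertBasis.mkOfOrthogonalEqBot orthonormal_legendreLp
    orthogonal_span_legendreLp).hasSum_inner_mul_inner (hf.toLp f) (hg.toLp g)
  rw [inner_toLp] at h
  refine h.congr_fun fun n => ?_
  rw [HilbertBasis.coe_mkOfOrthogonalEqBot, legendreLp, inner_smul_left, inner_smul_right,
    inner_toLp, inner_toLp]
  simp only [conj_trivial, shiftedP_eq_eval, innerProd]
  have hs := Real.mul_self_sqrt (show 0 ≤ (2 * (n : ℝ) + 1) * (2 / Real.pi) by positivity)
  linear_combination (-(∫ x in (0 : ℝ)..(Real.pi / 2), f x * (legendrePoly n).eval x) *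
    ∫ x in (0 : ℝ)..(Real.pi / 2), (legendrePoly n).eval x * g x) * hs

/-! ### Abel summation of the Fourier series of `log tan` -/

/-- The Abel means of the Fourier series of `log tan`. -/
noncomputable def abelLogTan (r x : ℝ) : ℝ :=
  (Real.log (1 + r ^ 2 - 2 * r * Real.cos (2 * x)) -
    Real.log (1 + r ^ 2 + 2 * r * Real.cos (2 * x))) / 2

theorem hasSum_abelLogTan {r : ℝ} (h0 : 0 ≤ r) (h1 : r < 1) (x : ℝ) :
    HasSum (fun n : ℕ => -((1 - (-1) ^ n) / n * (r ^ n * Real.cos (2 * n * x))))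
      (abelLogTan r x) := by
  set z : ℂ := r * Complex.exp ((2 * x : ℝ) * Complex.I) with hz
  have hnz : ‖z‖ = r := by
    rw [hz, norm_mul, Complex.norm_exp_ofReal_mul_I, mul_one, Complex.norm_real,
      Real.norm_of_nonneg h0]
  have hre : z.re = r * Real.cos (2 * x) := by
    rw [hz, Complex.re_ofReal_mul, Complex.exp_ofReal_mul_I_re]
  have hnsq : z.re * z.re + z.im * z.im = r ^ 2 := by
    rw [← Complex.normSq_apply, Complex.normSq_eq_norm_sq, hnz]
  have hlog : ∀ w : ℂ, (Complex.log w).re = Real.log (Complex.normSq w) / 2 := fun w => by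
    rw [Complex.log_re, Complex.normSq_eq_norm_sq, Real.log_pow]
    push_cast; ring
  have hs := Complex.hasSum_re
    ((Complex.hasSum_taylorSeries_neg_log (z := -z) (by rwa [norm_neg, hnz])).sub
      (Complex.hasSum_taylorSeries_neg_log (z := z) (by rwa [hnz])))
  convert! hs using 1
  · ext n
    have hpow : (z ^ n).re = r ^ n * Real.cos (2 * n * x) := by
      rw [hz, mul_pow, ← Complex.exp_nat_mul, ← Complex.ofReal_pow, Complex.re_ofReal_mul,
        show (n : ℂ) * ((2 * x : ℝ) * Complex.I) = ((2 * n * x : ℝ) : ℂ) * Complex.I by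
          push_cast; ring, Complex.exp_ofReal_mul_I_re]
    have : (-z) ^ n / (n : ℂ) - z ^ n / (n : ℂ) = ((-((1 - (-1) ^ n) / n) : ℝ) : ℂ) * z ^ n := by
      rw [neg_pow]; push_cast; ring
    rw [this, Complex.re_ofReal_mul, hpow]
    ring
  · rw [Complex.sub_re, Complex.neg_re, Complex.neg_re, hlog, hlog, abelLogTan,
      show Complex.normSq (1 - z) = 1 + r ^ 2 - 2 * r * Real.cos (2 * x) by
        rw [Complex.normSq_apply]; simp only [Complex.sub_re, Complex.sub_im, Complex.one_re,
          Complex.one_im]; linear_combination hnsq - 2 * hre,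
      show Complex.normSq (1 - -z) = 1 + r ^ 2 + 2 * r * Real.cos (2 * x) by
        rw [Complex.normSq_apply]; simp only [Complex.sub_re, Complex.sub_im, Complex.one_re,
          Complex.one_im, Complex.neg_re, Complex.neg_im]; linear_combination hnsq + 2 * hre]
    ring

theorem abelLogTan_one {x : ℝ} (hx : x ∈ Set.Ioo 0 (Real.pi / 2)) :
    abelLogTan 1 x = Real.log (Real.tan x) := by
  have hs : 0 < Real.sin x := Real.sin_pos_of_pos_of_lt_pi hx.1 (by linarith [hx.2, Real.pi_pos])
  have hc : 0 < Real.cos x := Real.cos_pos_of_mem_Ioo ⟨by linarith [hx.1, Real.pi_pos], hx.2⟩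
  have e1 : 1 + 1 ^ 2 - 2 * 1 * Real.cos (2 * x) = (2 * Real.sin x) ^ 2 := by
    rw [Real.cos_two_mul]; linear_combination (-4) * Real.sin_sq_add_cos_sq x
  have e2 : 1 + 1 ^ 2 + 2 * 1 * Real.cos (2 * x) = (2 * Real.cos x) ^ 2 := by
    rw [Real.cos_two_mul]; ring
  rw [abelLogTan, e1, e2, log_tan_eq hx, Real.log_pow, Real.log_pow, Real.log_mul two_ne_zero hs.ne',
    Real.log_mul two_ne_zero hc.ne']
  push_cast; ring

theorem abs_cos_two_mul_lt_one {x : ℝ} (hx : x ∈ Set.Ioo 0 (Real.pi / 2)) :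
    |Real.cos (2 * x)| < 1 := by
  have hs : 0 < Real.sin (2 * x) :=
    Real.sin_pos_of_pos_of_lt_pi (by linarith [hx.1]) (by linarith [hx.2])
  rw [← sq_lt_one_iff_abs_lt_one]
  nlinarith [Real.sin_sq_add_cos_sq (2 * x)]

theorem one_add_sq_sub_pos {r c : ℝ} (hr : 0 ≤ r) (hc : |c| < 1) :
    0 < 1 + r ^ 2 - 2 * r * c ∧ 0 < 1 + r ^ 2 + 2 * r * c := by
  obtain ⟨h1, h2⟩ := abs_lt.mp hc
  constructor <;> nlinarith [sq_nonneg (1 - r), mul_nonneg hr (sub_nonneg.mpr h2.le),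
    mul_nonneg hr (by linarith : 0 ≤ 1 + c), sq_nonneg (r - c), sq_nonneg (r + c)]

theorem abs_abelLogTan_le {r x : ℝ} (hr : 0 ≤ r) (hx : x ∈ Set.Ioo 0 (Real.pi / 2)) :
    |abelLogTan r x| ≤ |Real.log (Real.tan x)| := by
  rw [← abelLogTan_one hx, abelLogTan, abelLogTan]
  have hc := abs_cos_two_mul_lt_one hx
  set c := Real.cos (2 * x)
  obtain ⟨p1, p2⟩ := one_add_sq_sub_pos hr hc
  obtain ⟨q1, q2⟩ := one_add_sq_sub_pos zero_le_one hc
  rw [← Real.log_div p1.ne' p2.ne', ← Real.log_div q1.ne' q2.ne', abs_div, abs_div]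
  gcongr 1
  rcases le_total 0 c with h | h
  · have a : (1 + 1 ^ 2 - 2 * 1 * c) / (1 + 1 ^ 2 + 2 * 1 * c) ≤
        (1 + r ^ 2 - 2 * r * c) / (1 + r ^ 2 + 2 * r * c) := by
      rw [div_le_div_iff₀ q2 p2]
      nlinarith [mul_nonneg h (sq_nonneg (1 - r))]
    have b : (1 + r ^ 2 - 2 * r * c) / (1 + r ^ 2 + 2 * r * c) ≤ 1 := by
      rw [div_le_one p2]
      nlinarith [mul_nonneg hr h]
    rw [abs_of_nonpos (Real.log_nonpos (by positivity) b),
      abs_of_nonpos (Real.log_nonpos (by positivity) (a.trans b))]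
    exact neg_le_neg (Real.log_le_log (by positivity) a)
  · have a : (1 + r ^ 2 - 2 * r * c) / (1 + r ^ 2 + 2 * r * c) ≤
        (1 + 1 ^ 2 - 2 * 1 * c) / (1 + 1 ^ 2 + 2 * 1 * c) := by
      rw [div_le_div_iff₀ p2 q2]
      nlinarith [mul_nonneg (neg_nonneg.mpr h) (sq_nonneg (1 - r))]
    have b : 1 ≤ (1 + r ^ 2 - 2 * r * c) / (1 + r ^ 2 + 2 * r * c) := by
      rw [one_le_div p2]
      nlinarith [mul_nonneg hr (neg_nonneg.mpr h)]
    rw [abs_of_nonneg (Real.log_nonneg b), abs_of_nonneg (Real.log_nonneg (b.trans a))]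
    exact Real.log_le_log (by positivity) a

theorem tendsto_abelLogTan {x : ℝ} (hx : x ∈ Set.Ioo 0 (Real.pi / 2)) :
    Tendsto (fun r => abelLogTan r x) (𝓝[<] 1) (𝓝 (Real.log (Real.tan x))) := by
  rw [← abelLogTan_one hx]
  obtain ⟨q1, q2⟩ := one_add_sq_sub_pos zero_le_one (abs_cos_two_mul_lt_one hx)
  have : ContinuousAt (fun r => abelLogTan r x) 1 := by
    unfold abelLogTan
    fun_prop (disch := first | exact q1.ne' | exact q2.ne')
  exact this.tendsto.mono_left nhdsWithin_le_nhds

theorem abs_one_sub_neg_one_pow_div_le (n : ℕ) : |(1 - (-1) ^ n) / (n : ℝ)| ≤ 2 := by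
  rcases Nat.eq_zero_or_pos n with rfl | hn
  · simp
  have h1 : (1 : ℝ) ≤ n := by exact_mod_cast hn
  rw [abs_div, abs_of_pos (by linarith : (0 : ℝ) < n), div_le_iff₀ (by linarith)]
  rcases neg_one_pow_eq_or ℝ n with h | h
  · simp [h]
  · rw [h]; norm_num; linarith

theorem hasSum_integral_mul_abelLogTan {p : ℝ → ℝ} (hp : Continuous p) {r : ℝ} (h0 : 0 ≤ r)
    (h1 : r < 1) :
    HasSum (fun n : ℕ => r ^ n * -((1 - (-1) ^ n) / n *
        ∫ x in (0 : ℝ)..(Real.pi / 2), p x * Real.cos (2 * n * x)))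
      (∫ x in (0 : ℝ)..(Real.pi / 2), p x * abelLogTan r x) := by
  obtain ⟨M, hM⟩ := isCompact_Icc.exists_bound_of_continuousOn
    (hp.continuousOn (s := Set.Icc 0 (Real.pi / 2)))
  have hsum : Summable fun n : ℕ => M * (2 * r ^ n) :=
    ((summable_geometric_of_lt_one h0 h1).mul_left 2).mul_left M
  have h := intervalIntegral.hasSum_integral_of_dominated_convergence (μ := volume) (a := 0)
    (b := Real.pi / 2)
    (F := fun (n : ℕ) x => p x * -((1 - (-1) ^ n) / n * (r ^ n * Real.cos (2 * n * x))))
    (f := fun x => p x * abelLogTan r x) (fun n _ => M * (2 * r ^ n))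
    (fun n => (by fun_prop : Continuous _).aestronglyMeasurable)
    (fun n => ae_of_all _ fun x hx => by
      rw [Set.uIoc_of_le (by positivity)] at hx
      have hMx := hM x (Set.Ioc_subset_Icc_self hx)
      have hM0 : 0 ≤ M := (norm_nonneg _).trans hMx
      rw [norm_mul, norm_neg, norm_mul, norm_mul, norm_pow, Real.norm_of_nonneg h0]
      refine mul_le_mul hMx (mul_le_mul (abs_one_sub_neg_one_pow_div_le n) ?_ (by positivity)
        (by norm_num)) (by positivity) hM0
      exact mul_le_of_le_one_right (by positivity) (Real.abs_cos_le_one _))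
    (ae_of_all _ fun x _ => hsum) intervalIntegrable_const
    (ae_of_all _ fun x _ => (hasSum_abelLogTan h0 h1 x).mul_left _)
  refine h.congr_fun fun n => ?_
  rw [← intervalIntegral.integral_const_mul, ← intervalIntegral.integral_neg,
    ← intervalIntegral.integral_const_mul]
  refine intervalIntegral.integral_congr fun x _ => ?_
  ring

theorem measurable_abelLogTan (r : ℝ) : Measurable (abelLogTan r) := by
  unfold abelLogTan
  fun_prop

/-- Termwise integration of the Fourier series of `log tan` against a continuous function whose
cosine coefficients decay fast enough. -/
theorem L_eq_of_hasSum {p : ℝ → ℝ} (hp : Continuous p) {s : ℝ}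
    (hs : HasSum (fun n : ℕ => (1 - (-1) ^ n) / (n : ℝ) *
        ∫ x in (0 : ℝ)..(Real.pi / 2), p x * Real.cos (2 * n * x)) s) :
    L p = -s := by
  have hmem : ∀ᶠ r : ℝ in 𝓝[<] 1, 0 ≤ r ∧ r < 1 := by
    filter_upwards [self_mem_nhdsWithin,
      nhdsWithin_le_nhds (Ici_mem_nhds (zero_lt_one' ℝ))] with r h1 h0 using ⟨h0, h1⟩
  have hae : ∀ᵐ x ∂(volume : Measure ℝ), x ∈ Set.uIoc 0 (Real.pi / 2) →
      x ∈ Set.Ioo 0 (Real.pi / 2) := by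
    have : ∀ᵐ x ∂(volume : Measure ℝ), x ≠ Real.pi / 2 := by simp [ae_iff]
    filter_upwards [this] with x hne hx
    rw [Set.uIoc_of_le (by positivity)] at hx
    exact ⟨hx.1, lt_of_le_of_ne hx.2 hne⟩
  obtain ⟨M, hM⟩ := isCompact_Icc.exists_bound_of_continuousOn
    (hp.continuousOn (s := Set.Icc 0 (Real.pi / 2)))
  have hint : IntervalIntegrable (fun x => M * |Real.log (Real.tan x)|) volume
      0 (Real.pi / 2) := by
    refine IntervalIntegrable.const_mul ?_ M
    rw [intervalIntegrable_iff_integrableOn_Ioo_of_le (by positivity)]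
    exact (memLp_log_tan.integrable (by norm_num)).abs
  have l1 : Tendsto (fun r => ∫ x in (0 : ℝ)..(Real.pi / 2), p x * abelLogTan r x) (𝓝[<] 1)
      (𝓝 (L p)) := by
    refine intervalIntegral.tendsto_integral_filter_of_dominated_convergence
      (fun x => M * |Real.log (Real.tan x)|) ?_ ?_ hint ?_
    · exact Eventually.of_forall fun r =>
        (hp.measurable.mul (measurable_abelLogTan r)).aestronglyMeasurable
    · filter_upwards [hmem] with r hr
      filter_upwards [hae] with x hx h
      have h' := hx h
      have hMx := hM x (Set.Ioo_subset_Icc_self h')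
      rw [norm_mul]
      exact mul_le_mul hMx (abs_abelLogTan_le hr.1 h') (norm_nonneg _)
        ((norm_nonneg _).trans hMx)
    · filter_upwards [hae] with x hx h
      exact (tendsto_abelLogTan (hx h)).const_mul _
  have l2 : Tendsto (fun r : ℝ => ∑' n : ℕ, r ^ n * -((1 - (-1) ^ n) / (n : ℝ) *
        ∫ x in (0 : ℝ)..(Real.pi / 2), p x * Real.cos (2 * n * x))) (𝓝[<] 1) (𝓝 (-s)) := by
    rw [← hs.neg.tsum_eq]
    refine tendsto_tsum_of_dominated_convergence hs.neg.summable.norm (fun n => ?_) ?_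
    · have : Tendsto (fun r : ℝ => r ^ n) (𝓝[<] 1) (𝓝 1) := by
        simpa using ((continuous_pow n).tendsto (1 : ℝ)).mono_left nhdsWithin_le_nhds
      simpa using this.mul_const (-((1 - (-1) ^ n) / (n : ℝ) *
        ∫ x in (0 : ℝ)..(Real.pi / 2), p x * Real.cos (2 * n * x)))
    · filter_upwards [hmem] with r hr n
      rw [norm_mul, norm_pow, Real.norm_of_nonneg hr.1]
      exact mul_le_of_le_one_left (norm_nonneg _) (pow_le_one₀ hr.1 hr.2.le)
  refine tendsto_nhds_unique (l1.congr' ?_) l2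
  filter_upwards [hmem] with r hr
  exact (hasSum_integral_mul_abelLogTan hp hr.1 hr.2).tsum_eq.symm

/-! ### The log-tangent integral of a polynomial -/

theorem integral_eval_mul_cos_step (p : ℝ[X]) {n : ℕ} (hn : n ≠ 0) :
    ∫ x in (0 : ℝ)..(Real.pi / 2), p.eval x * Real.cos (2 * n * x) =
      ((-1) ^ n * (derivative p).eval (Real.pi / 2) - (derivative p).eval 0) / (2 * n) ^ 2 -
        (∫ x in (0 : ℝ)..(Real.pi / 2),
          (derivative (derivative p)).eval x * Real.cos (2 * n * x)) / (2 * n) ^ 2 := by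
  have hn' : (n : ℝ) ≠ 0 := by exact_mod_cast hn
  have hsin : ∀ x : ℝ, HasDerivAt (fun x => Real.sin (2 * n * x) / (2 * n))
      (Real.cos (2 * n * x)) x := fun x => by
    have h := (((hasDerivAt_id x).const_mul (2 * n : ℝ)).sin).div_const (2 * n : ℝ)
    convert! h using 1
    simp only [id, mul_one]
    field_simp
  have hcos : ∀ x : ℝ, HasDerivAt (fun x => -Real.cos (2 * n * x) / (2 * n) ^ 2)
      (Real.sin (2 * n * x) / (2 * n)) x := fun x => by
    have h := (((hasDerivAt_id x).const_mul (2 * n : ℝ)).cos).neg.div_const ((2 * n : ℝ) ^ 2)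
    convert! h using 1
    simp only [id, mul_one]
    field_simp
  have i1 := intervalIntegral.integral_mul_deriv_eq_deriv_mul (a := 0) (b := Real.pi / 2)
    (fun x _ => p.hasDerivAt x) (fun x _ => hsin x)
    ((derivative p).continuous.intervalIntegrable _ _)
    ((by fun_prop : Continuous fun x : ℝ => Real.cos (2 * n * x)).intervalIntegrable _ _)
  have i2 := intervalIntegral.integral_mul_deriv_eq_deriv_mul (a := 0) (b := Real.pi / 2)
    (fun x _ => (derivative p).hasDerivAt x) (fun x _ => hcos x)
    ((derivative (derivative p)).continuous.intervalIntegrable _ _)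
    ((by fun_prop : Continuous fun x : ℝ => Real.sin (2 * n * x) / (2 * n)).intervalIntegrable _ _)
  have ha : 2 * (n : ℝ) * (Real.pi / 2) = n * Real.pi := by ring
  rw [i1, i2, ha, Real.sin_nat_mul_pi, Real.cos_nat_mul_pi]
  have e : ∀ x : ℝ, (derivative (derivative p)).eval x * (-Real.cos (2 * n * x) / (2 * n) ^ 2) =
      -(1 / (2 * n) ^ 2) * ((derivative (derivative p)).eval x * Real.cos (2 * n * x)) :=
    fun x => by ring
  simp_rw [e]
  rw [intervalIntegral.integral_const_mul]
  simp
  ring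

theorem integral_eval_mul_cos (p : ℝ[X]) {n : ℕ} (hn : n ≠ 0) (K : ℕ)
    (hp : derivative^[2 * K] p = 0) :
    ∫ x in (0 : ℝ)..(Real.pi / 2), p.eval x * Real.cos (2 * n * x) =
      ∑ k ∈ Finset.range K, (-1) ^ k * ((-1) ^ n * (derivative^[2 * k + 1] p).eval (Real.pi / 2) -
        (derivative^[2 * k + 1] p).eval 0) / (2 * n) ^ (2 * k + 2) := by
  induction K generalizing p with
  | zero =>
    simp only [mul_zero, Function.iterate_zero, id_eq] at hp
    simp [hp]
  | succ K ih =>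
    rw [integral_eval_mul_cos_step p hn, ih (derivative (derivative p)) hp,
      Finset.sum_range_succ', Finset.sum_div]
    have e : ∀ k : ℕ, derivative^[2 * (k + 1) + 1] p =
        derivative^[2 * k + 1] (derivative (derivative p)) := fun k => rfl
    simp_rw [e]
    rw [sub_eq_neg_add, ← Finset.sum_neg_distrib]
    congr 1
    · refine Finset.sum_congr rfl fun k _ => ?_
      rw [show 2 * (k + 1) + 2 = (2 * k + 2) + 2 by ring, pow_add _ (2 * k + 2), pow_succ,
        ← div_div]
      ring
    · simp

theorem hasSum_one_sub_neg_one_pow_div {s : ℕ} (hs : 1 < s) :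
    HasSum (fun n : ℕ => (1 - (-1) ^ n) / (n : ℝ) ^ s)
      (2 * (1 - 1 / 2 ^ s) * ∑' n : ℕ, 1 / (n : ℝ) ^ s) := by
  have hz : HasSum (fun n : ℕ => 1 / (n : ℝ) ^ s) (∑' n : ℕ, 1 / (n : ℝ) ^ s) :=
    (Real.summable_one_div_nat_pow.mpr hs).hasSum
  set Z := ∑' n : ℕ, 1 / (n : ℝ) ^ s
  have heven : HasSum (fun n : ℕ => (1 + (-1) ^ n) / (n : ℝ) ^ s) (2 / 2 ^ s * Z + 0) := by
    refine HasSum.even_add_odd ((hz.mul_left (2 / 2 ^ s)).congr_fun fun k => ?_)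
      (hasSum_zero.congr_fun fun k => ?_)
    · rw [pow_mul]; push_cast; rw [mul_pow]; norm_num; field_simp
    · rw [pow_succ, pow_mul]; norm_num
  convert! (hz.mul_left 2).sub heven using 1
  · ext n; ring
  · ring

theorem L_eval (p : ℝ[X]) (K : ℕ) (hp : derivative^[2 * K] p = 0) :
    L (fun x => p.eval x) = ∑ k ∈ Finset.range K, (-1) ^ k *
      ((derivative^[2 * k + 1] p).eval (Real.pi / 2) + (derivative^[2 * k + 1] p).eval 0) /
        4 ^ (k + 1) * (2 * (1 - 1 / 2 ^ (2 * k + 3)) * ∑' n : ℕ, 1 / (n : ℝ) ^ (2 * k + 3)) := by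
  have h : HasSum (fun n : ℕ => ∑ k ∈ Finset.range K, -((-1) ^ k *
      ((derivative^[2 * k + 1] p).eval (Real.pi / 2) + (derivative^[2 * k + 1] p).eval 0) /
        4 ^ (k + 1)) * ((1 - (-1) ^ n) / (n : ℝ) ^ (2 * k + 3))) _ :=
    hasSum_sum fun k _ => (hasSum_one_sub_neg_one_pow_div (by lia : 1 < 2 * k + 3)).mul_left _
  rw [L_eq_of_hasSum p.continuous (h.congr_fun fun n => ?_), ← Finset.sum_neg_distrib]
  · exact Finset.sum_congr rfl fun k _ => by ring
  · rcases Nat.eq_zero_or_pos n with rfl | hn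
    · simp
    have hn' : (n : ℝ) ≠ 0 := by positivity
    rw [integral_eval_mul_cos p hn.ne' K hp, Finset.mul_sum]
    refine Finset.sum_congr rfl fun k _ => ?_
    have h4 : ((2 : ℝ) * n) ^ (2 * k + 2) = 4 ^ (k + 1) * (n : ℝ) ^ (2 * k + 2) := by
      rw [mul_pow, show 2 * k + 2 = 2 * (k + 1) by ring, pow_mul 2]; norm_num
    rw [h4, show 2 * k + 3 = (2 * k + 2) + 1 by ring, pow_succ (n : ℝ)]
    rcases neg_one_pow_eq_or ℝ n with h | h <;> rw [h]
    · simp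
    · field_simp; ring

/-! ### The log-tangent integrals of the Legendre polynomials -/

theorem L_shiftedP (n K : ℕ) (hK : n < 2 * K) :
    L (shiftedP n) = ∑ k ∈ Finset.range K, (-1) ^ k *
      ((1 - (-1) ^ n) * (derivative^[2 * k + 1] (legendrePoly n)).eval 0) /
        4 ^ (k + 1) * (2 * (1 - 1 / 2 ^ (2 * k + 3)) * ∑' m : ℕ, 1 / (m : ℝ) ^ (2 * k + 3)) := by
  rw [show shiftedP n = fun x => (legendrePoly n).eval x from funext (shiftedP_eq_eval n),
    L_eval _ K (iterate_derivative_eq_zero (by rwa [natDegree_legendrePoly]))]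
  refine Finset.sum_congr rfl fun k _ => ?_
  rw [eval_iterate_derivative_legendrePoly_pi_div_two, ← add_assoc, pow_succ _ (n + 2 * k),
    pow_add, pow_mul]
  norm_num
  ring_nf
  simp

theorem L_shiftedP_even (j : ℕ) : L (shiftedP (2 * j)) = 0 := by
  rw [L_shiftedP (2 * j) (j + 1) (by lia)]
  simp

theorem eval_iterate_derivative_legendrePoly_odd_zero {j k : ℕ} (h : k ≤ j) :
    (derivative^[2 * k + 1] (legendrePoly (2 * j + 1))).eval 0 =
      (2 / Real.pi) ^ (2 * k + 1) * (((2 * j + 2 * k + 2).factorial : ℝ) /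
        ((2 * k + 1).factorial * (2 * j - 2 * k).factorial)) := by
  rw [eval_iterate_derivative_legendrePoly_zero,
    show 2 * j + 1 + (2 * k + 1) = 2 * (j + k + 1) by ring, pow_mul (-1 : ℝ)]
  rw [Nat.cast_choose ℝ (by lia : 2 * k + 1 ≤ 2 * j + 1),
    Nat.cast_choose ℝ (by lia : 2 * j + 1 ≤ 2 * (j + k + 1)),
    show 2 * j + 1 - (2 * k + 1) = 2 * j - 2 * k by lia,
    show 2 * (j + k + 1) - (2 * j + 1) = 2 * k + 1 by lia,
    show 2 * (j + k + 1) = 2 * j + 2 * k + 2 by ring]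
  have h1 : ((2 * j + 1).factorial : ℝ) ≠ 0 := by positivity
  have h2 : ((2 * k + 1).factorial : ℝ) ≠ 0 := by positivity
  have h3 : ((2 * j - 2 * k).factorial : ℝ) ≠ 0 := by positivity
  field_simp
  norm_num

theorem L_shiftedP_odd {j : ℕ} (hj : 1 ≤ j) :
    L (shiftedP (2 * j - 1)) = ∑ k ∈ Finset.Icc 1 j,
      2 * ((Nat.factorial (2 * j + 2 * k - 2) : ℝ) /
        ((Nat.factorial (2 * k - 1) : ℝ) * (Nat.factorial (2 * j - 2 * k) : ℝ))) *
      ((-1) ^ (k - 1) / Real.pi ^ (2 * k - 1)) * (1 - 1 / 2 ^ (2 * k + 1)) *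
        ∑' m : ℕ, 1 / (m : ℝ) ^ (2 * k + 1) := by
  obtain ⟨i, rfl⟩ : ∃ i, j = i + 1 := ⟨j - 1, by lia⟩
  rw [show 2 * (i + 1) - 1 = 2 * i + 1 by lia, L_shiftedP (2 * i + 1) (i + 1) (by lia),
    show Finset.Icc 1 (i + 1) = Finset.Ico 1 (i + 2) by ext; simp; lia,
    Finset.sum_Ico_eq_sum_range]
  refine Finset.sum_congr rfl fun k hk => ?_
  have hki : k ≤ i := by simpa [Nat.lt_succ_iff] using hk
  rw [eval_iterate_derivative_legendrePoly_odd_zero hki,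
    show 2 * (i + 1) + 2 * (1 + k) - 2 = 2 * i + 2 * k + 2 by lia,
    show 2 * (1 + k) - 1 = 2 * k + 1 by lia, show 2 * (i + 1) - 2 * (1 + k) = 2 * i - 2 * k by lia,
    show 1 + k - 1 = k by lia, show 2 * (1 + k) + 1 = 2 * k + 3 by ring, pow_succ (-1 : ℝ) (2 * i),
    pow_mul (-1 : ℝ) 2 i, div_pow,
    show (4 : ℝ) ^ (k + 1) = 2 ^ (2 * k + 1) * 2 by
      rw [← pow_succ, show 2 * k + 1 + 1 = 2 * (k + 1) by ring, pow_mul]; norm_num]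
  have h1 : ((2 * k + 1).factorial : ℝ) ≠ 0 := by positivity
  have h2 : ((2 * i - 2 * k).factorial : ℝ) ≠ 0 := by positivity
  have h3 := Real.pi_ne_zero
  generalize ∑' m : ℕ, 1 / (m : ℝ) ^ (2 * k + 3) = Z
  field_simp
  norm_num

/-- The Legendre expansion of the log-tangent integral. -/
theorem tendsto_sum_innerProd_mul_L {f : ℝ → ℝ}
    (hf : MemLp f 2 (volume.restrict (Set.Ioo 0 (Real.pi / 2)))) :
    Tendsto (fun N : ℕ => ∑ j ∈ Finset.Icc 1 N,
      (4 * (j : ℝ) - 1) * innerProd f (shiftedP (2 * j - 1)) * L (shiftedP (2 * j - 1)))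
      atTop (𝓝 (L f)) := by
  have h := (hasSum_legendre_parseval hf memLp_log_tan).tendsto_sum_nat.comp
    (tendsto_id.const_mul_atTop' (zero_lt_two' ℕ))
  refine h.congr fun N => ?_
  simp only [Function.comp_apply, id]
  induction N with
  | zero => simp
  | succ N ih =>
    rw [show 2 * (N + 1) = 2 * N + 1 + 1 by ring, Finset.sum_range_succ, Finset.sum_range_succ, ih,
      Finset.sum_Icc_succ_top (by lia)]
    have he := L_shiftedP_even N
    rw [L] at he
    rw [he, show 2 * (N + 1) - 1 = 2 * N + 1 by lia, L]
    push_cast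
    ring

theorem sum_coeff_mul (f : ℝ → ℝ) (N : ℕ) (z : ℕ → ℝ) :
    ∑ k ∈ Finset.Icc 1 N, coeff f N k * z k = ∑ j ∈ Finset.Icc 1 N,
      (4 * (j : ℝ) - 1) * innerProd f (shiftedP (2 * j - 1)) * ∑ k ∈ Finset.Icc 1 j,
        2 * ((Nat.factorial (2 * j + 2 * k - 2) : ℝ) /
          ((Nat.factorial (2 * k - 1) : ℝ) * (Nat.factorial (2 * j - 2 * k) : ℝ))) * z k := by
  simp_rw [coeff, Finset.mul_sum, Finset.sum_mul]
  rw [Finset.sum_comm' (t' := Finset.Icc 1 N) (s' := fun j => Finset.Icc 1 j)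
    (by simp only [Finset.mem_Icc]; lia)]
  exact Finset.sum_congr rfl fun j _ => Finset.sum_congr rfl fun k _ => by ring

theorem riemannZeta_odd_eq_ofReal {k : ℕ} (hk : 1 ≤ k) :
    riemannZeta (2 * (k : ℂ) + 1) = ((∑' m : ℕ, 1 / (m : ℝ) ^ (2 * k + 1) : ℝ) : ℂ) := by
  have h := zeta_nat_eq_tsum_of_gt_one (by lia : 1 < 2 * k + 1)
  push_cast at h ⊢
  exact h

end LogTangent

theorem mainTheorem7 (f : ℝ → ℝ)
    (hf : MemLp f 2 (volume.restrict (Set.Ioo 0 (Real.pi / 2)))) :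
    IntegrableOn (fun x => f x * Real.log (Real.tan x)) (Set.Ioo 0 (Real.pi / 2)) ∧
    Tendsto
      (fun N : ℕ => ∑ k ∈ Finset.Icc 1 N,
        (LogTangent.coeff f N k : ℂ) * ((-1) ^ (k - 1) / (Real.pi : ℂ) ^ (2 * k - 1)) *
          (1 - 1 / 2 ^ (2 * k + 1)) * riemannZeta (2 * (k : ℂ) + 1))
      atTop (𝓝 (LogTangent.L f : ℂ)) := by
  refine ⟨hf.integrable_mul LogTangent.memLp_log_tan, ?_⟩
  have h := (Complex.continuous_ofReal.tendsto _).comp (LogTangent.tendsto_sum_innerProd_mul_L hf)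
  refine h.congr fun N => ?_
  simp only [Function.comp_apply]
  have e : ∑ k ∈ Finset.Icc 1 N,
      (LogTangent.coeff f N k : ℂ) * ((-1) ^ (k - 1) / (Real.pi : ℂ) ^ (2 * k - 1)) *
          (1 - 1 / 2 ^ (2 * k + 1)) * riemannZeta (2 * (k : ℂ) + 1) =
      ((∑ k ∈ Finset.Icc 1 N, LogTangent.coeff f N k *
        ((-1) ^ (k - 1) / Real.pi ^ (2 * k - 1) * (1 - 1 / 2 ^ (2 * k + 1)) *
          ∑' m : ℕ, 1 / (m : ℝ) ^ (2 * k + 1)) : ℝ) : ℂ) := by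
    rw [Complex.ofReal_sum]
    refine Finset.sum_congr rfl fun k hk => ?_
    rw [LogTangent.riemannZeta_odd_eq_ofReal (Finset.mem_Icc.mp hk).1]
    push_cast
    ring
  rw [e, LogTangent.sum_coeff_mul]
  congr 1
  refine Finset.sum_congr rfl fun j hj => ?_
  rw [LogTangent.L_shiftedP_odd (Finset.mem_Icc.mp hj).1]
  congr 1
  exact Finset.sum_congr rfl fun k _ => by ring
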